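/- For $n\ge 4$ let $\Delta_n^4$ be the group with generators $(ijkl)$, one for each quadruple of integers $1\le i<j<k<l\le n$, and relations (1) $(ijkl)^2=1$; (2) $(ijkl)(stuv)=(stuv)(ijkl)$ whenever $|\{i,j,k,l\}\cap\{s,t,u,v\}|\le 2$; (3) $(ijkl)(ijlm)(jklm)(ijkm)(iklm)=1$ for all $1\le i<j<k<l<m\le n$. Theorem. The group $\Delta_5^4$ has a subgroup $G$ of index $2$ whose abelianization satisfies $H_1(G)\cong \mathbb{Z}^2\oplus(\mathbb{Z}/2\mathbb{Z})$. Moreover, $\Delta_5^4$ is infinite and non-commutative, and it does not have Kazhdan's Property (T) (as a discrete group); that is, there are no finite subset $Q\subset\Delta_5^4$ and $\varepsilon>0$ such that every unitary representation $\pi$ of $\Delta_5^4$ on a complex Hilbert space having a nonzero vector $\xi$ with $\|\pi(g)\xi-\xi\|<\varepsilon\|\xi\|$ for all $g\in Q$ also has a nonzero $\pi$-invariant vector. -/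

import Mathlib

/-- An increasing quadruple `i < j < k < l` in an `n`-element linearly ordered set; it indexes the
generator `(ijkl)`. (`Fin n` stands for `{1, …, n}`.) -/
@[ext]
structure IncQuad (n : ℕ) where
  i : Fin n
  j : Fin n
  k : Fin n
  l : Fin n
  hij : i < j
  hjk : j < k
  hkl : k < l

namespace IncQuad

/-- The underlying set `{i, j, k, l}` of an increasing quadruple. -/
def support {n : ℕ} (q : IncQuad n) : Finset (Fin n) := {q.i, q.j, q.k, q.l}

end IncQuad

/-- The relators of the group `Δ_n^4`, as words in the free group on the increasing quadruples. -/
inductive IsDeltaRelator (n : ℕ) : FreeGroup (IncQuad n) → Prop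
  /-- `(ijkl)² = 1` -/
  | involutive (q : IncQuad n) :
      IsDeltaRelator n (FreeGroup.of q ^ 2)
  /-- `(ijkl)(stuv) = (stuv)(ijkl)` whenever `|{i,j,k,l} ∩ {s,t,u,v}| ≤ 2` -/
  | commutative (p q : IncQuad n) (h : (p.support ∩ q.support).card ≤ 2) :
      IsDeltaRelator n
        ((FreeGroup.of p * FreeGroup.of q) * (FreeGroup.of q * FreeGroup.of p)⁻¹)
  /-- `(ijkl)(ijlm)(jklm)(ijkm)(iklm) = 1` whenever `i < j < k < l < m` -/
  | pentagon (i j k l m : Fin n) (hij : i < j) (hjk : j < k) (hkl : k < l) (hlm : l < m) :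
      IsDeltaRelator n
        (FreeGroup.of ⟨i, j, k, l, hij, hjk, hkl⟩ *
         FreeGroup.of ⟨i, j, l, m, hij, hjk.trans hkl, hlm⟩ *
         FreeGroup.of ⟨j, k, l, m, hjk, hkl, hlm⟩ *
         FreeGroup.of ⟨i, j, k, m, hij, hjk, hkl.trans hlm⟩ *
         FreeGroup.of ⟨i, k, l, m, hij.trans hjk, hkl, hlm⟩)

/-- The group `Δ_n^4`. -/
abbrev Delta4 (n : ℕ) : Type := PresentedGroup {r | IsDeltaRelator n r}

universe u

/-- Kazhdan's Property (T) for a discrete group `Γ`: there is a Kazhdan pair `(Q, ε)` with `Q` a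
finite (that is, compact) subset of `Γ` and `ε > 0`, so that every unitary representation of `Γ` on
a complex Hilbert space that has a `(Q, ε)`-invariant vector has a nonzero invariant vector.

It is enough to let the Hilbert space range over the universe of `Γ`: the closed subspace
spanned by the orbit of a `(Q, ε)`-invariant vector is a subrepresentation, and it is isomorphic to
a completion of a quotient of `Γ →₀ ℂ`. -/
def HasPropertyT (Γ : Type u) [Group Γ] : Prop :=
  ∃ (Q : Finset Γ) (ε : ℝ), 0 < ε ∧
    ∀ (H : Type u) [NormedAddCommGroup H] [InnerProductSpace ℂ H] [CompleteSpace H]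
      (π : Γ →* (H ≃ₗᵢ[ℂ] H)),
      (∃ ξ : H, ξ ≠ 0 ∧ ∀ g ∈ Q, ‖π g ξ - ξ‖ < ε * ‖ξ‖) →
        ∃ η : H, η ≠ 0 ∧ ∀ g : Γ, π g η = η

namespace IncQuad

/-! Two 4-subsets of a 5-element set share at least three points, so no commutation relation occurs
and `Δ_5^4` is generated by five involutions subject only to `abcde = 1` (`exists_hom`).

Sending `a, b` to one reflection, `c, d` to another and `e` to `1` maps it onto the infinite
dihedral group. Hence it is infinite and non-commutative; letting the two reflections act on `ℂ²` in
distinct but nearly equal lines gives almost invariant vectors without invariant ones.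

For the index-two subgroup, take the kernel of the sign `a, b, c, d ↦ -1`, `e ↦ 1`. Its
abelianization is generated by the classes of `ba`, `ca` and `e`, the last of order dividing 2, so
it is a quotient of `ℤ² × ℤ/2`. A homomorphism to the generalized dihedral group of `ℤ² × ℤ/2` shows
that nothing more collapses. -/

lemma card_support {n : ℕ} (q : IncQuad n) : q.support.card = 4 := by
  have h1 := q.hij
  have h2 := q.hjk
  have h3 := q.hkl
  have h4 := h1.trans h2
  have h5 := h2.trans h3
  have h6 := h4.trans h3
  simp [support, h1.ne, h2.ne, h3.ne, h4.ne, h5.ne, h6.ne]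

lemma two_lt_card_support_inter (p q : IncQuad 5) : 2 < (p.support ∩ q.support).card := by
  have h := Finset.card_union_add_card_inter p.support q.support
  have h' := Finset.card_le_univ (p.support ∪ q.support)
  rw [card_support, card_support] at h
  rw [Fintype.card_fin] at h'
  omega

end IncQuad

namespace Delta4

/-! ### Presentation by five involutions -/

/-- The generator `(1234)` of `Δ_5^4`. -/
def a : Delta4 5 := PresentedGroup.of ⟨0, 1, 2, 3, by decide, by decide, by decide⟩

/-- The generator `(1245)` of `Δ_5^4`. -/
def b : Delta4 5 := PresentedGroup.of ⟨0, 1, 3, 4, by decide, by decide, by decide⟩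

/-- The generator `(2345)` of `Δ_5^4`. -/
def c : Delta4 5 := PresentedGroup.of ⟨1, 2, 3, 4, by decide, by decide, by decide⟩

/-- The generator `(1235)` of `Δ_5^4`. -/
def d : Delta4 5 := PresentedGroup.of ⟨0, 1, 2, 4, by decide, by decide, by decide⟩

/-- The generator `(1345)` of `Δ_5^4`. -/
def e : Delta4 5 := PresentedGroup.of ⟨0, 2, 3, 4, by decide, by decide, by decide⟩

lemma of_mul_self {n : ℕ} (q : IncQuad n) :
    (PresentedGroup.of q : Delta4 n) * PresentedGroup.of q = 1 := by
  have h := PresentedGroup.one_of_mem (rels := {r | IsDeltaRelator n r})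
    (IsDeltaRelator.involutive q)
  rwa [sq, map_mul] at h

lemma a_mul_a : a * a = 1 := of_mul_self _
lemma b_mul_b : b * b = 1 := of_mul_self _
lemma c_mul_c : c * c = 1 := of_mul_self _
lemma d_mul_d : d * d = 1 := of_mul_self _
lemma e_mul_e : e * e = 1 := of_mul_self _

lemma a_mul_b_mul_c_mul_d_mul_e : a * b * c * d * e = 1 := by
  have h := PresentedGroup.one_of_mem (rels := {r | IsDeltaRelator 5 r})
    (IsDeltaRelator.pentagon 0 1 2 3 4 (by decide) (by decide) (by decide) (by decide))
  rw [map_mul, map_mul, map_mul, map_mul] at h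
  exact h

lemma closure_generators : Subgroup.closure ({a, b, c, d, e} : Set (Delta4 5)) = ⊤ := by
  rw [eq_top_iff, ← PresentedGroup.closure_range_of]
  apply Subgroup.closure_mono
  rintro _ ⟨⟨i, j, k, l, hij, hjk, hkl⟩, rfl⟩
  have key : (i = 0 ∧ j = 1 ∧ k = 2 ∧ l = 3) ∨ (i = 0 ∧ j = 1 ∧ k = 3 ∧ l = 4) ∨
      (i = 1 ∧ j = 2 ∧ k = 3 ∧ l = 4) ∨ (i = 0 ∧ j = 1 ∧ k = 2 ∧ l = 4) ∨
      (i = 0 ∧ j = 2 ∧ k = 3 ∧ l = 4) := by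
    omega
  rcases key with ⟨rfl, rfl, rfl, rfl⟩ | ⟨rfl, rfl, rfl, rfl⟩ | ⟨rfl, rfl, rfl, rfl⟩ |
    ⟨rfl, rfl, rfl, rfl⟩ | ⟨rfl, rfl, rfl, rfl⟩
  · exact Or.inl rfl
  · exact Or.inr (Or.inl rfl)
  · exact Or.inr (Or.inr (Or.inl rfl))
  · exact Or.inr (Or.inr (Or.inr (Or.inl rfl)))
  · exact Or.inr (Or.inr (Or.inr (Or.inr rfl)))

/-- Induction on elements of `Δ_5^4`, multiplying by generators on the right. -/
lemma induction_right {P : Delta4 5 → Prop} (one : P 1) (mul_a : ∀ x, P x → P (x * a))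
    (mul_b : ∀ x, P x → P (x * b)) (mul_c : ∀ x, P x → P (x * c))
    (mul_d : ∀ x, P x → P (x * d)) (mul_e : ∀ x, P x → P (x * e)) (x : Delta4 5) : P x := by
  have hx : x ∈ Subgroup.closure ({a, b, c, d, e} : Set (Delta4 5)) := by
    rw [closure_generators]; trivial
  induction hx using Subgroup.closure_induction_right with
  | one => exact one
  | mul_right x _ y hy hP =>
    rcases hy with rfl | rfl | rfl | rfl | rfl
    exacts [mul_a x hP, mul_b x hP, mul_c x hP, mul_d x hP, mul_e x hP]
  | mul_inv_cancel x _ y hy hP =>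
    rcases hy with rfl | rfl | rfl | rfl | rfl
    · rw [inv_eq_of_mul_eq_one_right a_mul_a]; exact mul_a x hP
    · rw [inv_eq_of_mul_eq_one_right b_mul_b]; exact mul_b x hP
    · rw [inv_eq_of_mul_eq_one_right c_mul_c]; exact mul_c x hP
    · rw [inv_eq_of_mul_eq_one_right d_mul_d]; exact mul_d x hP
    · rw [inv_eq_of_mul_eq_one_right e_mul_e]; exact mul_e x hP

/-- The universal property of `Δ_5^4`: it is generated by five involutions `a, b, c, d, e` subject
to `abcde = 1`. -/
lemma exists_hom {T : Type*} [Group T] (A B C D E : T) (hA : A * A = 1) (hB : B * B = 1)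
    (hC : C * C = 1) (hD : D * D = 1) (hE : E * E = 1) (h : A * B * C * D * E = 1) :
    ∃ f : Delta4 5 →* T, f a = A ∧ f b = B ∧ f c = C ∧ f d = D ∧ f e = E := by
  -- Indices start at 0; the tests, in this order, separate the five quadruples.
  let g : IncQuad 5 → T := fun q =>
    if q.i = 1 then C else if q.j = 2 then E else if q.k = 3 then B else if q.l = 4 then D else A
  have hg : ∀ r ∈ {r | IsDeltaRelator 5 r}, FreeGroup.lift g r = 1 := by
    rintro r (q | ⟨p, q, hpq⟩ | ⟨i, j, k, l, m, hij, hjk, hkl, hlm⟩)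
    · rw [sq, map_mul, FreeGroup.lift_apply_of]
      dsimp only [g]
      split_ifs <;> assumption
    · exact absurd hpq (IncQuad.two_lt_card_support_inter p q).not_ge
    · obtain ⟨rfl, rfl, rfl, rfl, rfl⟩ : i = 0 ∧ j = 1 ∧ k = 2 ∧ l = 3 ∧ m = 4 := by omega
      simp only [map_mul, FreeGroup.lift_apply_of]
      exact h
  exact ⟨PresentedGroup.toGroup hg, PresentedGroup.toGroup.of hg, PresentedGroup.toGroup.of hg,
    PresentedGroup.toGroup.of hg, PresentedGroup.toGroup.of hg, PresentedGroup.toGroup.of hg⟩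

/-! ### Infinite dihedral quotient -/

/-- `Δ_5^4` surjects onto the infinite dihedral group. -/
lemma exists_surjective_dihedralGroup :
    ∃ f : Delta4 5 →* DihedralGroup 0, Function.Surjective f := by
  obtain ⟨f, ha, -, hc, -, -⟩ := exists_hom (T := DihedralGroup 0) (.sr 0) (.sr 0) (.sr 1) (.sr 1) 1
    (by simp) (by simp) (by simp) (by simp) (by simp) (by simp)
  have hr : f (a * c) = .r 1 := by rw [map_mul, ha, hc, DihedralGroup.sr_mul_sr, sub_zero]
  have hz : ∀ i : ZMod 0, f ((a * c) ^ (show ℤ from i)) = .r i := by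
    intro i
    rw [map_zpow, hr, DihedralGroup.r_one_zpow]
    rfl
  refine ⟨f, ?_⟩
  rintro (i | i)
  · exact ⟨_, hz i⟩
  · exact ⟨a * (a * c) ^ (show ℤ from i), by
      rw [map_mul, hz, ha, DihedralGroup.sr_mul_r, zero_add]⟩

lemma infinite : Infinite (Delta4 5) :=
  let ⟨f, hf⟩ := exists_surjective_dihedralGroup
  Infinite.of_surjective f hf

lemma exists_not_commute : ∃ x y : Delta4 5, x * y ≠ y * x := by
  obtain ⟨f, hf⟩ := exists_surjective_dihedralGroup
  obtain ⟨x, hx⟩ := hf (.sr 0)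
  obtain ⟨y, hy⟩ := hf (.r 1)
  refine ⟨x, y, fun h => ?_⟩
  have h' := congrArg f h
  rw [map_mul, map_mul, hx, hy, DihedralGroup.sr_mul_r, DihedralGroup.r_mul_sr] at h'
  exact absurd (DihedralGroup.sr.inj h') (by decide)

/-! ### Failure of Property (T) -/

open Filter Topology in
/-- A family of unitary representations which moves a vector `ξ` by an amount tending to zero on
each of the generators moves `ξ` by an amount tending to zero on each group element. -/
lemma tendsto_norm_sub {ι H : Type*} [NormedAddCommGroup H] [InnerProductSpace ℂ H]
    {l : Filter ι} (π : ι → Delta4 5 →* (H ≃ₗᵢ[ℂ] H)) (ξ : H)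
    (ha : Tendsto (fun t => ‖π t a ξ - ξ‖) l (𝓝 0)) (hb : Tendsto (fun t => ‖π t b ξ - ξ‖) l (𝓝 0))
    (hc : Tendsto (fun t => ‖π t c ξ - ξ‖) l (𝓝 0)) (hd : Tendsto (fun t => ‖π t d ξ - ξ‖) l (𝓝 0))
    (he : Tendsto (fun t => ‖π t e ξ - ξ‖) l (𝓝 0)) (g : Delta4 5) :
    Tendsto (fun t => ‖π t g ξ - ξ‖) l (𝓝 0) := by
  have hmul : ∀ x y : Delta4 5, Tendsto (fun t => ‖π t y ξ - ξ‖) l (𝓝 0) →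
      Tendsto (fun t => ‖π t x ξ - ξ‖) l (𝓝 0) →
      Tendsto (fun t => ‖π t (x * y) ξ - ξ‖) l (𝓝 0) := by
    intro x y hy hx
    refine squeeze_zero (fun _ => norm_nonneg _) (fun t => ?_) (by simpa using hy.add hx)
    calc ‖π t (x * y) ξ - ξ‖ = ‖π t x (π t y ξ - ξ) + (π t x ξ - ξ)‖ := by
          rw [map_mul, map_sub, sub_add_sub_cancel]; rfl
      _ ≤ ‖π t y ξ - ξ‖ + ‖π t x ξ - ξ‖ := by
          refine (norm_add_le _ _).trans_eq ?_
          rw [LinearIsometryEquiv.norm_map]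
  induction g using induction_right with
  | one => simpa using tendsto_const_nhds
  | mul_a x hx => exact hmul x a ha hx
  | mul_b x hx => exact hmul x b hb hx
  | mul_c x hx => exact hmul x c hc hx
  | mul_d x hx => exact hmul x d hd hx
  | mul_e x hx => exact hmul x e he hx

open Filter Topology in
/-- The representations used here factor through the infinite dihedral group: its two generating
involutions act as the reflections of `ℂ²` in two lines at a small angle. -/
lemma not_hasPropertyT : ¬ HasPropertyT (Delta4 5) := by
  rintro ⟨Q, ε, hε, hT⟩
  let u : EuclideanSpace ℂ (Fin 2) := !₂[1, 0]
  let v : ℝ → EuclideanSpace ℂ (Fin 2) := fun t => !₂[1, (t : ℂ)]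
  let R := fun w : EuclideanSpace ℂ (Fin 2) => (ℂ ∙ w).reflection
  have hR : ∀ w, R w * R w = 1 := fun w => Submodule.reflection_mul_reflection _
  have hRfix : ∀ w, R w w = w := fun w =>
    Submodule.reflection_mem_subspace_eq_self (Submodule.mem_span_singleton_self w)
  choose π ha hb hc hd he using fun t : ℝ =>
    exists_hom (R u) (R u) (R (v t)) (R (v t)) 1 (hR u) (hR u) (hR (v t)) (hR (v t)) (mul_one 1)
      (by rw [hR u, one_mul, hR (v t), mul_one])
  have hu : ‖u‖ = 1 := by simp [u, EuclideanSpace.norm_eq]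
  have hcont : Continuous v := by
    refine (PiLp.continuous_toLp 2 _).comp (continuous_pi fun i => ?_)
    fin_cases i
    · exact continuous_const
    · exact Complex.continuous_ofReal
  have hv0 : v 0 = u := by simp [u, v]
  have hlim : Tendsto (fun t => ‖R (v t) u - u‖) (𝓝[≠] 0) (𝓝 0) := by
    have h1 : Tendsto (fun t => 2 * ‖u - v t‖) (𝓝[≠] 0) (𝓝 0) := by
      have : Tendsto (fun t => 2 * ‖u - v t‖) (𝓝 0) (𝓝 (2 * ‖u - v 0‖)) :=
        Continuous.tendsto (by fun_prop) 0
      rw [hv0, sub_self, norm_zero, mul_zero] at this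
      exact this.mono_left nhdsWithin_le_nhds
    -- The reflection fixes `v t`, so it moves `u` by at most twice the distance from `u` to `v t`.
    refine squeeze_zero (fun _ => norm_nonneg _) (fun t => ?_) h1
    calc ‖R (v t) u - u‖ = ‖R (v t) (u - v t) - (u - v t)‖ := by
          rw [map_sub, hRfix, sub_sub_sub_cancel_right]
      _ ≤ 2 * ‖u - v t‖ := by
          refine (norm_sub_le _ _).trans_eq ?_
          rw [LinearIsometryEquiv.norm_map, two_mul]
  have hev : ∀ g ∈ Q, ∀ᶠ t in 𝓝[≠] (0 : ℝ), ‖π t g u - u‖ < ε * ‖u‖ := by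
    intro g _
    refine (tendsto_norm_sub π u ?_ ?_ ?_ ?_ ?_ g).eventually_lt_const (by rw [hu]; linarith)
    · simp [ha, hRfix]
    · simp [hb, hRfix]
    · simpa only [hc] using hlim
    · simpa only [hd] using hlim
    · simp [he]
  -- The neighbourhood is punctured because at `t = 0` the two lines coincide and `u` is invariant.
  obtain ⟨t, hQ, ht⟩ :=
    (((eventually_all_finset Q).2 hev).and eventually_mem_nhdsWithin).exists
  obtain ⟨η, hη, hinv⟩ := hT _ (π t) ⟨u, by rw [← norm_ne_zero_iff, hu]; exact one_ne_zero, hQ⟩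
  have h1 : η ∈ ℂ ∙ u := by
    rw [← Submodule.reflection_eq_self_iff]
    simpa only [ha] using hinv a
  have h2 : η ∈ ℂ ∙ v t := by
    rw [← Submodule.reflection_eq_self_iff]
    simpa only [hc] using hinv c
  obtain ⟨x, rfl⟩ := Submodule.mem_span_singleton.1 h1
  obtain ⟨y, hy⟩ := Submodule.mem_span_singleton.1 h2
  have hy0 := congrArg (fun w : EuclideanSpace ℂ (Fin 2) => w 0) hy
  have hy1 := congrArg (fun w : EuclideanSpace ℂ (Fin 2) => w 1) hy
  have ht' : t ≠ 0 := ht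
  have hyx : y = x := by simpa [u, v] using hy0
  have hy' : y = 0 := by simpa [u, v, ht'] using hy1
  exact hη (by rw [← hyx, hy', zero_smul])

/-! ### The index-two subgroup and its abelianization -/

/-- The abelian group which is the abelianization of the index-two subgroup. -/
abbrev AbModel : Type := (ℤ × ℤ) × ZMod 2

/-- The action of `{±1}` on `AbModel` by sign. -/
def signAction : ℤˣ →* MulAut (Multiplicative AbModel) :=
  (MulAutMultiplicative AbModel).symm.toMonoidHom.comp (DistribMulAction.toAddAut ℤˣ AbModel)

lemma signAction_neg_one (x : AbModel) :
    signAction (-1) (Multiplicative.ofAdd x) = Multiplicative.ofAdd (-x) := by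
  change Multiplicative.ofAdd ((-1 : ℤˣ) • x) = _
  rw [Units.neg_smul, one_smul]

/-- The generalized dihedral group of `AbModel`. -/
abbrev GenDihedral : Type := Multiplicative AbModel ⋊[signAction] ℤˣ

/-- The elements of the generalized dihedral group. -/
def mk (x : AbModel) (s : ℤˣ) : GenDihedral := ⟨Multiplicative.ofAdd x, s⟩

lemma mk_one_mul (x y : AbModel) (s : ℤˣ) : mk x 1 * mk y s = mk (x + y) s := by
  refine SemidirectProduct.ext ?_ (one_mul s)
  change Multiplicative.ofAdd x * signAction 1 (Multiplicative.ofAdd y) = _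
  rw [map_one]
  rfl

lemma mk_neg_one_mul (x y : AbModel) (s : ℤˣ) : mk x (-1) * mk y s = mk (x - y) (-s) := by
  refine SemidirectProduct.ext ?_ (by change (-1 : ℤˣ) * s = -s; rw [neg_one_mul])
  change Multiplicative.ofAdd x * signAction (-1) (Multiplicative.ofAdd y) = _
  rw [signAction_neg_one, sub_eq_add_neg]
  rfl

lemma mk_zero_one : mk 0 1 = 1 := rfl

/-- Four generators become point reflections and `e` the translation of order 2. The image of `d` is
then forced by `abcde = 1`. -/
lemma exists_hom_genDihedral : ∃ f : Delta4 5 →* GenDihedral,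
    f a = mk 0 (-1) ∧ f b = mk ((1, 0), 0) (-1) ∧ f c = mk ((0, 1), 0) (-1) ∧
      f d = mk ((-1, 1), 1) (-1) ∧ f e = mk ((0, 0), 1) 1 := by
  apply exists_hom <;> simp only [mk_one_mul, mk_neg_one_mul, neg_neg, ← mk_zero_one] <;>
    congr 1

/-- Every element of `Δ_5^4` lies in the subgroup generated by `ba, ca, da, e, aea` or in its
coset by `a`. -/
lemma mem_or_mul_a_mem (S : Subgroup (Delta4 5)) (hb : b * a ∈ S) (hc : c * a ∈ S)
    (hd : d * a ∈ S) (he : e ∈ S) (hae : a * e * a ∈ S) (x : Delta4 5) : x ∈ S ∨ x * a ∈ S := by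
  have step : ∀ x s : Delta4 5, s * s = 1 → s * a ∈ S → x ∈ S ∨ x * a ∈ S →
      x * s ∈ S ∨ x * s * a ∈ S := by
    -- Right multiplication by such an `s` exchanges the two alternatives.
    rintro x s hs hsa (hx | hx)
    · exact Or.inr (by simpa only [mul_assoc] using S.mul_mem hx hsa)
    · refine Or.inl ?_
      have h := S.mul_mem hx (S.inv_mem hsa)
      rwa [mul_inv_rev, inv_eq_of_mul_eq_one_right hs, mul_assoc, mul_inv_cancel_left] at h
  induction x using induction_right with
  | one => exact Or.inl S.one_mem
  | mul_a x hx => exact step x a a_mul_a (by rw [a_mul_a]; exact S.one_mem) hx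
  | mul_b x hx => exact step x b b_mul_b hb hx
  | mul_c x hx => exact step x c c_mul_c hc hx
  | mul_d x hx => exact step x d d_mul_d hd hx
  | mul_e x hx =>
    rcases hx with hx | hx
    · exact Or.inl (S.mul_mem hx he)
    · refine Or.inr ?_
      have h : x * a * (a * e * a) = x * e * a := by
        rw [← mul_assoc, ← mul_assoc, mul_assoc x, a_mul_a, mul_one]
      rw [← h]
      exact S.mul_mem hx hae

lemma exists_index_two : ∃ G : Subgroup (Delta4 5), G.index = 2 ∧
    Nonempty (Additive (Abelianization G) ≃+ (ℤ × ℤ) × ZMod 2) := by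
  obtain ⟨f, fa, fb, fc, fd, fe⟩ := exists_hom_genDihedral
  let sgn : Delta4 5 →* ℤˣ := SemidirectProduct.rightHom.comp f
  have hsgn : ∀ x s t, f x = mk s t → sgn x = t := fun x s t h => by
    change (f x).right = t
    rw [h]
    rfl
  have hindex : sgn.ker.index = 2 := by
    have hsurj : Function.Surjective sgn := by
      intro s
      rcases Int.units_eq_one_or s with rfl | rfl
      · exact ⟨1, map_one _⟩
      · exact ⟨a, hsgn _ _ _ fa⟩
    rw [Subgroup.index_ker, MonoidHom.range_eq_top.2 hsurj, Subgroup.card_top]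
    simp
  refine ⟨sgn.ker, hindex, ?_⟩
  have fba : f (b * a) = mk ((1, 0), 0) 1 := by
    rw [map_mul, fb, fa, mk_neg_one_mul, neg_neg, sub_zero]
  have fca : f (c * a) = mk ((0, 1), 0) 1 := by
    rw [map_mul, fc, fa, mk_neg_one_mul, neg_neg, sub_zero]
  have fda : f (d * a) = mk ((-1, 1), 1) 1 := by
    rw [map_mul, fd, fa, mk_neg_one_mul, neg_neg, sub_zero]
  have faea : f (a * e * a) = mk ((0, 0), 1) 1 := by
    rw [map_mul, map_mul, fa, fe, mk_neg_one_mul, mk_neg_one_mul, neg_neg]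
    rfl
  have key : ∀ x s, f x = mk s 1 → x ∈ sgn.ker := fun x s h => hsgn x s 1 h
  let gB : sgn.ker := ⟨b * a, key _ _ fba⟩
  let gC : sgn.ker := ⟨c * a, key _ _ fca⟩
  let gD : sgn.ker := ⟨d * a, key _ _ fda⟩
  let gE : sgn.ker := ⟨e, key _ _ fe⟩
  let gF : sgn.ker := ⟨a * e * a, key _ _ faea⟩
  -- the translation part, a homomorphism on the subgroup
  let τ : sgn.ker →* Multiplicative AbModel :=
    { toFun := fun x => (f x).left
      map_one' := by simp
      map_mul' := fun x y => by
        have hx : (f x).right = 1 := x.2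
        simp [SemidirectProduct.mul_left, hx] }
  have hτ : ∀ (x : sgn.ker) s, f x = mk s 1 → τ x = Multiplicative.ofAdd s := fun x s h => by
    change (f x).left = _
    rw [h]
    rfl
  let F : Additive (Abelianization sgn.ker) →+ AbModel :=
    MonoidHom.toAdditiveLeft (Abelianization.lift τ)
  let O : sgn.ker → Additive (Abelianization sgn.ker) := fun x =>
    Additive.ofMul (Abelianization.of x)
  have O_mul : ∀ x y, O (x * y) = O x + O y := fun x y => by
    change Additive.ofMul (Abelianization.of (x * y)) = _
    rw [map_mul]
    rfl
  have O_one : O 1 = 0 := rfl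
  have O_inv : ∀ x, O x⁻¹ = -O x := fun x => by
    change Additive.ofMul (Abelianization.of x⁻¹) = _
    rw [map_inv]
    rfl
  have FO : ∀ x s, f x.1 = mk s 1 → F (O x) = s := fun x s h => by
    change Multiplicative.toAdd (Abelianization.lift τ (Abelianization.of x)) = s
    rw [Abelianization.lift_apply_of, hτ x s h]
    rfl
  have hE : O gE + O gE = 0 := by
    rw [← O_mul, ← O_one]
    congr 1
    exact Subtype.ext e_mul_e
  -- This is `abcde = 1` regrouped as `(ab)(ca)(ad)e`.
  have hD : O gD = -O gB + O gC + O gE := by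
    have h : gB⁻¹ * gC * gD⁻¹ * gE = 1 := by
      apply Subtype.ext
      change (b * a)⁻¹ * (c * a) * (d * a)⁻¹ * e = 1
      rw [mul_inv_rev, mul_inv_rev, inv_eq_of_mul_eq_one_right a_mul_a,
        inv_eq_of_mul_eq_one_right b_mul_b, inv_eq_of_mul_eq_one_right d_mul_d,
        ← a_mul_b_mul_c_mul_d_mul_e]
      simp only [mul_assoc]
      rw [← mul_assoc a a, a_mul_a, one_mul]
    have h' := congrArg O h
    rw [O_mul, O_mul, O_mul, O_inv, O_inv, O_one] at h'
    rw [← sub_eq_zero, ← neg_eq_zero, ← h']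
    abel
  -- Since `e = dcba`, one has `aea = (ad)(ca)(ab)`, whose class is `-O gE` by `hD`, hence `O gE` by
  -- `hE`.
  have hF : O gF = O gE := by
    have h : gF = gD⁻¹ * gC * gB⁻¹ := by
      apply Subtype.ext
      change a * e * a = (d * a)⁻¹ * (c * a) * (b * a)⁻¹
      have he : e = (a * b * c * d)⁻¹ := (inv_eq_of_mul_eq_one_right a_mul_b_mul_c_mul_d_mul_e).symm
      rw [he]
      simp only [mul_inv_rev, inv_eq_of_mul_eq_one_right a_mul_a,
        inv_eq_of_mul_eq_one_right b_mul_b, inv_eq_of_mul_eq_one_right c_mul_c,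
        inv_eq_of_mul_eq_one_right d_mul_d, mul_assoc]
      rw [a_mul_a, mul_one, ← mul_assoc a a, a_mul_a, one_mul]
    rw [h, O_mul, O_mul, O_inv, O_inv, hD, ← sub_eq_zero, ← neg_eq_zero, ← hE]
    abel
  let K : AbModel →+ Additive (Abelianization sgn.ker) :=
    AddMonoidHom.coprod
      (AddMonoidHom.coprod (zmultiplesHom _ (O gB)) (zmultiplesHom _ (O gC)))
      (ZMod.lift 2 ⟨zmultiplesHom _ (O gE), by simpa [two_zsmul] using hE⟩)
  have K1 : ∀ m n : ℤ, ∀ w : ℤ, K ((m, n), (w : ZMod 2)) = m • O gB + n • O gC + w • O gE := by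
    intro m n w
    simp [K]
  have hS : ∀ x : sgn.ker, K (F (O x)) = O x := by
    let T : Subgroup sgn.ker :=
      { carrier := {x | K (F (O x)) = O x}
        one_mem' := by
          change K (F (O 1)) = O 1
          rw [O_one, map_zero, map_zero]
        mul_mem' := fun {x y} hx hy => by
          change K (F (O (x * y))) = O (x * y)
          rw [O_mul, map_add, map_add]
          exact congrArg₂ _ hx hy
        inv_mem' := fun {x} hx => by
          change K (F (O x⁻¹)) = O x⁻¹
          rw [O_inv, map_neg, map_neg]
          exact congrArg _ hx }
    have hB' : gB ∈ T := by
      change K (F (O gB)) = O gB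
      rw [FO gB _ fba]
      simpa using K1 1 0 0
    have hC' : gC ∈ T := by
      change K (F (O gC)) = O gC
      rw [FO gC _ fca]
      simpa using K1 0 1 0
    have hD' : gD ∈ T := by
      change K (F (O gD)) = O gD
      rw [FO gD _ fda, hD]
      simpa using K1 (-1) 1 1
    have hE' : gE ∈ T := by
      change K (F (O gE)) = O gE
      rw [FO gE _ fe]
      simpa using K1 0 0 1
    have hF' : gF ∈ T := by
      change K (F (O gF)) = O gF
      rw [FO gF _ faea, hF]
      simpa using K1 0 0 1
    rintro ⟨x, hx⟩
    have hcase := mem_or_mul_a_mem (T.map sgn.ker.subtype) ⟨gB, hB', rfl⟩ ⟨gC, hC', rfl⟩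
      ⟨gD, hD', rfl⟩ ⟨gE, hE', rfl⟩ ⟨gF, hF', rfl⟩ x
    -- The second case is impossible: `x` has sign `1`, so `x * a` has sign `-1`.
    rcases hcase with ⟨y, hy, rfl⟩ | ⟨y, -, hy⟩
    · exact hy
    · have h1 : sgn (x * a) = 1 := by
        rw [← hy]
        exact y.2
      rw [map_mul, MonoidHom.mem_ker.1 hx, hsgn a _ _ fa] at h1
      exact absurd h1 (by decide)
  refine ⟨AddMonoidHom.toAddEquiv F K ?_ ?_⟩
  · refine AddMonoidHom.ext fun q => ?_
    obtain ⟨x, rfl⟩ : ∃ x, O x = q := QuotientGroup.mk_surjective q.toMul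
    exact hS x
  · refine AddMonoidHom.ext ?_
    rintro ⟨⟨m, n⟩, w⟩
    obtain ⟨w, rfl⟩ := ZMod.intCast_surjective w
    rw [AddMonoidHom.comp_apply, K1, map_add, map_add, map_zsmul, map_zsmul, map_zsmul,
      FO gB _ fba, FO gC _ fca, FO gE _ fe]
    simp

end Delta4

theorem theorem6p4 :
    (∃ G : Subgroup (Delta4 5), G.index = 2 ∧
      Nonempty (Additive (Abelianization G) ≃+ (ℤ × ℤ) × ZMod 2)) ∧
    Infinite (Delta4 5) ∧
    (∃ x y : Delta4 5, x * y ≠ y * x) ∧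
    ¬ HasPropertyT (Delta4 5) :=
  ⟨Delta4.exists_index_two, Delta4.infinite, Delta4.exists_not_commute, Delta4.not_hasPropertyT⟩
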